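/- For $x\in\mathbb{R}$ let $\langle x\rangle$ be the nearest integer to $x$, with $\langle n+\tfrac12\rangle=n$ for $n\in\mathbb{Z}$, and for $\mu\in\mathbb{C}$ let $\{\mu\}=\mu-\langle\operatorname{Re}\mu\rangle$, so that $-\tfrac12<\operatorname{Re}\{\mu\}\le\tfrac12$. Let $$J_\mu(z)=\Big(\frac z2\Big)^{\mu}\sum_{k=0}^\infty\frac{(-1)^k(z/2)^{2k}}{k!\,\Gamma(\mu+k+1)},\qquad I_\mu(z)=e^{-i\mu\pi/2}J_\mu(iz)$$ be the Bessel and modified Bessel functions of the first kind (with $1/\Gamma=0$ at the poles of $\Gamma$), and let $P(\nu,w)=\gamma(\nu,w)/\Gamma(\nu)$ be the normalised lower incomplete gamma function, where $$\gamma(\nu,w)=w^\nu\sum_{m=0}^\infty\frac{(-w)^m}{(\nu+m)\,m!}\qquad(\nu\ne0,-1,-2,\dots),$$ and $P(\nu,w)=1$ for $\nu=0,-1,-2,\dots$. All powers are principal values, with $\arg\in(-\pi,\pi]$. **Corollary.** Let $\mu\in\mathbb{C}$ and let $z\in\mathbb{C}\setminus\{0\}$ with $-\pi<\arg z\le\frac\pi2$.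 Then $$I_\mu(z)=\frac1\pi\int_0^\pi e^{z\cos\theta}\,P\big(\{\mu\},z(1+\cos\theta)\big)\cos(\mu\theta)\,d\theta+\frac{1}{\sqrt\pi}\,e^{-z}\sum_{j=1}^{-\langle\operatorname{Re}\mu\rangle}\frac{\Gamma(j+\mu-\frac12)}{\Gamma(j)\,\Gamma(j+2\mu)}\,(2z)^{j+\mu-1},$$ where the integral converges absolutely and the sum is zero if $\langle\operatorname{Re}\mu\rangle\ge0$, i.e. if $\operatorname{Re}\mu>-\frac12$. If $\mu$ is a negative integer, the coefficients of the sum are zero, because $1/\Gamma(j+2\mu)=0$. If $\mu\in\{-\frac12,-\frac32,-\frac52,\dots\}$, the coefficient $\frac{\Gamma(j+\mu-1/2)}{\Gamma(j)\Gamma(j+2\mu)}$, in which both $\Gamma(j+\mu-\frac12)$ and $\Gamma(j+2\mu)$ have a pole, is understood as the limit of $\frac{\Gamma(j+s-1/2)}{\Gamma(j)\Gamma(j+2s)}$ as $s\to\mu$, $s\ne\mu$; this limit exists. (For every other $\mu$ this limit exists as well and is the value of the coefficient.) -/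

import Mathlib

noncomputable section

namespace MixedBessel

/-- The nearest integer `⟨x⟩` of a real number, where ties are rounded down:
`⟨n + 1/2⟩ = n` for `n : ℤ`. -/
def nearestInt (x : ℝ) : ℤ := ⌈x - 1 / 2⌉

/-- The complex fractional part `{μ} = μ - ⟨Re μ⟩`. -/
def fracPart (μ : ℂ) : ℂ := μ - (nearestInt μ.re : ℂ)

theorem nearestInt_add_half (n : ℤ) : nearestInt ((n : ℝ) + 1 / 2) = n := by
  simp [nearestInt]

theorem fracPart_re_mem (μ : ℂ) : (fracPart μ).re ∈ Set.Ioc (-(1 / 2) : ℝ) (1 / 2) := by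
  have h1 := Int.le_ceil (μ.re - 1 / 2)
  have h2 := Int.ceil_lt_add_one (μ.re - 1 / 2)
  simp only [fracPart, nearestInt, Complex.sub_re, Complex.intCast_re, Set.mem_Ioc]
  constructor <;> linarith

/-- The Bessel function of the first kind `J_μ(z)` (principal branch of `(z/2)^μ`), by its power
series. `1/Γ` vanishes at the poles of `Γ` (in Mathlib `Γ` takes the value `0` there), so this is
the standard function for every complex `μ`, negative integers included. -/
def besselJ (μ z : ℂ) : ℂ :=
  (z / 2) ^ μ *
    ∑' k : ℕ, (-1) ^ k * (z / 2) ^ (2 * k) / ((k.factorial : ℂ) * Complex.Gamma (μ + k + 1))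

/-- The modified Bessel function of the first kind, `I_μ(z) = e^{-iμπ/2} J_μ(iz)`. -/
def besselI (μ z : ℂ) : ℂ :=
  Complex.exp (-Complex.I * μ * Real.pi / 2) * besselJ μ (Complex.I * z)

/-- The lower incomplete gamma function `γ(ν, w) = w^ν ∑ (-w)^m / ((ν + m) m!)`, for
`ν ≠ 0, -1, -2, …` (principal branch of `w^ν`). For `0 < Re ν` it is `∫₀ʷ t^{ν-1} e^{-t} dt`, and
the series is its analytic continuation in `ν`. -/
def lowerIncGamma (ν w : ℂ) : ℂ :=
  w ^ ν * ∑' m : ℕ, (-w) ^ m / ((ν + m) * (m.factorial : ℂ))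

open Classical in
/-- The normalised incomplete gamma function `P(ν, w) = γ(ν, w) / Γ(ν)`, with its limit value `1`
at `ν = 0, -1, -2, …`. -/
def regIncGamma (ν w : ℂ) : ℂ :=
  if ∃ n : ℕ, ν = -(n : ℂ) then 1 else lowerIncGamma ν w / Complex.Gamma ν

/-- The quotient `Γ(j + μ - 1/2) / (Γ(j) Γ(j + 2μ))`, read literally. -/
def gammaQuotient (j : ℤ) (μ : ℂ) : ℂ :=
  Complex.Gamma (j + μ - 1 / 2) / (Complex.Gamma j * Complex.Gamma (j + 2 * μ))

open Classical in
/-- The coefficients `Γ(j + μ - 1/2) / (Γ(j) Γ(j + 2μ))` of the finite sum, understood in the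
limiting form when `μ` is a negative half-integer (both singular gamma factors then have a pole). -/
def sumCoeff (j : ℤ) (μ : ℂ) : ℂ :=
  if ∃ m : ℤ, m ≤ -1 ∧ μ = (m : ℂ) + 1 / 2 then
    Filter.limUnder (nhdsWithin μ {μ}ᶜ) (gammaQuotient j)
  else gammaQuotient j μ

end MixedBessel

end

/-! ### Taylor coefficients of the modified Bessel function times an exponential -/

noncomputable section

namespace MixedBessel

open Complex Filter Topology PowerSeries

/-! Both sides are compared as series in `z`. Write `I_μ(z) = (z/2)^μ e^{-z} ∑ c_k z^k`. Multiplying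
by `e^z` turns Bessel's equation into one of Kummer type, so the `c_k` obey a first-order recurrence
(`kummerCoeff_succ`), and Legendre duplication identifies them, up to `√π 2^{-2μ-k}`, with
`Γ(μ+k+1/2) / (k! Γ(2μ+k+1))` (`sumCoeff_eq`). Since `c_k` is entire in `μ`, the exceptional `μ`
follow by continuity.

On the integral side put `n = ⟨Re μ⟩`, `ν = {μ} = μ - n`. From `P(ν,w) = w^ν e^{-w} ∑ w^m /
Γ(ν+1+m)` (`regIncGamma_eq`), the integrand is `e^{-z} cos(μθ)` times a series in powers `(z(1+cos
θ))^{ν+m}`. Cauchy's formula for `∫ (1+cos θ)^s cos((s-k)θ)` (`integral_one_add_cos_cpow_mul_cos`),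
with `s = ν+m` and `k = m-n`, shows that the `m`-th term integrates to `π e^{-z} (z/2)^μ c_k z^k`,
read as zero for `k < 0`. So the integral yields all `k ≥ -n`; if `n < 0`, the missing `k = 0, …,
-n-1` are the finite sum (`tsum_intExtend_add_sum`). -/

theorem summable_norm_pow_mul_inv_Gamma (a w : ℂ) :
    Summable fun m : ℕ => ‖w ^ m * (Gamma (a + m))⁻¹‖ := by
  refine Summable.norm ?_
  refine summable_of_ratio_norm_eventually_le (r := 1 / 2) (by norm_num) ?_
  have hev : ∀ᶠ m : ℕ in atTop, ‖a‖ + 2 * ‖w‖ + 1 ≤ (m : ℝ) :=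
    tendsto_natCast_atTop_atTop.eventually_ge_atTop _
  filter_upwards [hev] with m hm
  have hle : 2 * ‖w‖ ≤ ‖a + m‖ := by
    have h := norm_sub_norm_le (m : ℂ) (-a)
    rw [norm_neg, Complex.norm_natCast, sub_neg_eq_add, add_comm (m : ℂ)] at h
    linarith
  have hstep : (Gamma (a + m))⁻¹ = (a + m) * (Gamma (a + (m + 1 : ℕ)))⁻¹ := by
    rw [one_div_Gamma_eq_self_mul_one_div_Gamma_add_one]
    push_cast
    rw [add_assoc]
  rw [hstep, norm_mul, norm_mul, norm_mul, pow_succ, norm_mul]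
  have := mul_le_mul_of_nonneg_right hle
    (mul_nonneg (norm_nonneg (w ^ m)) (norm_nonneg (Gamma (a + (m + 1 : ℕ)))⁻¹))
  nlinarith [this]

theorem tsum_mul_tsum_eq_tsum_coeff_mul (f g : PowerSeries ℂ) (w : ℂ)
    (hf : Summable fun n => ‖coeff n f * w ^ n‖) (hg : Summable fun n => ‖coeff n g * w ^ n‖) :
    (∑' n, coeff n f * w ^ n) * (∑' n, coeff n g * w ^ n) = ∑' n, coeff n (f * g) * w ^ n := by
  rw [tsum_mul_tsum_eq_tsum_sum_antidiagonal_of_summable_norm hf hg]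
  refine tsum_congr fun n => ?_
  rw [coeff_mul, Finset.sum_mul]
  refine Finset.sum_congr rfl fun p hp => ?_
  rw [← Finset.HasAntidiagonal.mem_antidiagonal.mp hp, pow_add]
  ring

theorem coeff_exp_mul_pow (n : ℕ) (w : ℂ) :
    coeff n (PowerSeries.exp ℂ) * w ^ n = w ^ n / (n.factorial : ℂ) := by
  rw [coeff_exp]
  simp [div_eq_inv_mul]

theorem summable_norm_coeff_exp (w : ℂ) :
    Summable fun n => ‖coeff n (PowerSeries.exp ℂ) * w ^ n‖ := by
  simp only [coeff_exp_mul_pow]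
  exact NormedSpace.norm_expSeries_div_summable w

theorem tsum_coeff_exp (w : ℂ) :
    ∑' n, coeff n (PowerSeries.exp ℂ) * w ^ n = Complex.exp w := by
  simp only [coeff_exp_mul_pow]
  rw [Complex.exp_eq_exp_ℂ, NormedSpace.exp_eq_tsum_div]

/-- The power series `∑ (X/2)^(2k) / (k! Γ(μ + k + 1))`. -/
def besselISeries (μ : ℂ) : PowerSeries ℂ :=
  PowerSeries.mk fun n => if Even n then
    (1 / 4) ^ (n / 2) / (((n / 2).factorial : ℂ) * Gamma (μ + (n / 2 : ℕ) + 1)) else 0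

theorem coeff_besselISeries_two_mul (μ : ℂ) (k : ℕ) :
    coeff (2 * k) (besselISeries μ) =
      (1 / 4) ^ k / ((k.factorial : ℂ) * Gamma (μ + k + 1)) := by
  simp [besselISeries]

theorem coeff_besselISeries_odd (μ : ℂ) (k : ℕ) :
    coeff (2 * k + 1) (besselISeries μ) = 0 := by
  simp [besselISeries]

theorem coeff_besselISeries_add_two (μ : ℂ) (n : ℕ) :
    ((n : ℂ) + 2) * (n + 2 + 2 * μ) * coeff (n + 2) (besselISeries μ) =
      coeff n (besselISeries μ) := by
  rcases Nat.even_or_odd' n with ⟨k, rfl | rfl⟩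
  · rw [show 2 * k + 2 = 2 * (k + 1) by ring, coeff_besselISeries_two_mul,
      coeff_besselISeries_two_mul, div_eq_mul_inv _ (_ * _), div_eq_mul_inv _ (_ * _), mul_inv,
      mul_inv, one_div_Gamma_eq_self_mul_one_div_Gamma_add_one (μ + k + 1), Nat.factorial_succ]
    have h1 : (k.factorial : ℂ) ≠ 0 := by exact_mod_cast k.factorial_ne_zero
    have h2 : (k : ℂ) + 1 ≠ 0 := by exact_mod_cast k.succ_ne_zero
    push_cast
    rw [show μ + ((k : ℂ) + 1) + 1 = μ + k + 1 + 1 by ring, pow_succ]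
    field_simp
    ring
  · rw [show 2 * k + 1 + 2 = 2 * (k + 1) + 1 by ring, coeff_besselISeries_odd,
      coeff_besselISeries_odd, mul_zero]

/-- The modified Bessel equation with the factor `(z/2)^μ` removed. It holds for every `μ`, since
`1/Γ(s) = s/Γ(s+1)` has no exceptions. -/
theorem besselISeries_ode (μ : ℂ) :
    X * d⁄dX ℂ (d⁄dX ℂ (besselISeries μ)) + C (2 * μ + 1) * d⁄dX ℂ (besselISeries μ) =
      X * besselISeries μ := by
  ext n
  rcases n with _ | n
  · rw [map_add, coeff_C_mul, coeff_zero_X_mul, coeff_zero_X_mul, coeff_derivative,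
      show 0 + 1 = 2 * 0 + 1 from rfl, coeff_besselISeries_odd]
    ring
  · rw [map_add, coeff_C_mul, coeff_succ_X_mul, coeff_succ_X_mul, coeff_derivative,
      coeff_derivative, ← coeff_besselISeries_add_two μ n]
    push_cast
    ring

/-- The Taylor coefficients of `e^z (z/2)^(-μ) I_μ(z)`. -/
def kummerCoeff (μ : ℂ) (n : ℕ) : ℂ := coeff n (PowerSeries.exp ℂ * besselISeries μ)

theorem kummerCoeff_zero (μ : ℂ) : kummerCoeff μ 0 = (Gamma (μ + 1))⁻¹ := by
  have := coeff_besselISeries_two_mul μ 0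
  simp only [mul_zero] at this
  simp [kummerCoeff, coeff_mul, this]

/-- With `y = e^x g`, the equation for `g` becomes `x y'' + (2μ+1) y' = 2x y' + (2μ+1) y`, which
links only consecutive coefficients. -/
theorem kummerCoeff_succ (μ : ℂ) (n : ℕ) :
    ((n : ℂ) + 1) * (n + 2 * μ + 1) * kummerCoeff μ (n + 1) =
      (2 * n + 2 * μ + 1) * kummerCoeff μ n := by
  set g := besselISeries μ with hg
  set e := PowerSeries.exp ℂ with he
  have hde : d⁄dX ℂ e = e := PowerSeries.derivative_exp ℂ
  have h1 : d⁄dX ℂ (e * g) = e * g + e * d⁄dX ℂ g := by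
    rw [Derivation.leibniz, hde, smul_eq_mul, smul_eq_mul]; ring
  have h2 : d⁄dX ℂ (e * d⁄dX ℂ g) = e * d⁄dX ℂ g + e * d⁄dX ℂ (d⁄dX ℂ g) := by
    rw [Derivation.leibniz, hde, smul_eq_mul, smul_eq_mul]; ring
  have hode : X * d⁄dX ℂ (d⁄dX ℂ (e * g)) + C (2 * μ + 1) * d⁄dX ℂ (e * g) =
      2 * (X * d⁄dX ℂ (e * g)) + C (2 * μ + 1) * (e * g) := by
    rw [h1, map_add, h1, h2]
    linear_combination e * besselISeries_ode μ
  have hc := congrArg (coeff n) hode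
  have htwo : (2 : PowerSeries ℂ) = C 2 := (map_ofNat C 2).symm
  rcases n with _ | n
  · rw [map_add (coeff _), map_add (coeff _), coeff_C_mul, coeff_C_mul, htwo, coeff_C_mul, coeff_zero_X_mul,
      coeff_zero_X_mul, coeff_derivative] at hc
    simp only [kummerCoeff]
    push_cast at hc ⊢
    linear_combination hc
  · rw [map_add (coeff _), map_add (coeff _), coeff_C_mul, coeff_C_mul, htwo, coeff_C_mul, coeff_succ_X_mul,
      coeff_succ_X_mul, coeff_derivative, coeff_derivative, coeff_derivative] at hc
    simp only [kummerCoeff]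
    push_cast at hc ⊢
    linear_combination hc

theorem continuous_kummerCoeff (n : ℕ) : Continuous fun μ => kummerCoeff μ n := by
  simp only [kummerCoeff, coeff_mul]
  refine continuous_finsetSum _ fun p _ => continuous_const.mul ?_
  rcases Nat.even_or_odd' p.2 with ⟨k, hk | hk⟩
  · simp only [hk, coeff_besselISeries_two_mul, div_eq_mul_inv, mul_inv]
    exact continuous_const.mul (continuous_const.mul
      (differentiable_one_div_Gamma.continuous.comp (by fun_prop)))
  · simp only [hk, coeff_besselISeries_odd]
    exact continuous_const

theorem hasSum_besselISeries (μ z : ℂ) :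
    (Summable fun n => ‖coeff n (besselISeries μ) * z ^ n‖) ∧
      ∑' n, coeff n (besselISeries μ) * z ^ n =
        ∑' k : ℕ, (z / 2) ^ (2 * k) / ((k.factorial : ℂ) * Gamma (μ + k + 1)) := by
  have hinj : Function.Injective fun k : ℕ => 2 * k := fun a b h => by simpa using h
  have hsupp : ∀ n ∉ Set.range (fun k : ℕ => 2 * k), coeff n (besselISeries μ) * z ^ n = 0 := by
    intro n hn
    rcases Nat.even_or_odd' n with ⟨k, rfl | rfl⟩
    · exact absurd ⟨k, rfl⟩ hn
    · rw [coeff_besselISeries_odd, zero_mul]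
  have hterm : ∀ k : ℕ, coeff (2 * k) (besselISeries μ) * z ^ (2 * k) =
      (z / 2) ^ (2 * k) / ((k.factorial : ℂ) * Gamma (μ + k + 1)) := by
    intro k
    rw [coeff_besselISeries_two_mul, div_pow z, pow_mul 2, one_div, inv_pow,
      show (2 : ℂ) ^ 2 = 4 by norm_num]
    ring
  constructor
  · rw [← hinj.summable_iff (fun n hn => by rw [hsupp n hn, norm_zero])]
    refine Summable.of_nonneg_of_le (fun _ => norm_nonneg _) (fun k => ?_)
      (summable_norm_pow_mul_inv_Gamma (μ + 1) ((z / 2) ^ 2))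
    simp only [Function.comp_apply]
    rw [hterm, div_eq_mul_inv, mul_inv, norm_mul, norm_mul, norm_mul, ← pow_mul,
      show μ + 1 + k = μ + k + 1 by ring]
    have hk : ‖(k.factorial : ℂ)⁻¹‖ ≤ 1 := by
      rw [norm_inv, Complex.norm_natCast]
      exact inv_le_one_of_one_le₀ (by exact_mod_cast k.factorial_pos)
    gcongr
    exact mul_le_of_le_one_left (norm_nonneg _) hk
  · rw [← hinj.tsum_eq]
    · exact tsum_congr hterm
    · intro n hn
      by_contra h
      exact hn (hsupp n h)

theorem exp_mul_tsum_eq_tsum_kummerCoeff (μ z : ℂ) :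
    Complex.exp z * ∑' k : ℕ, (z / 2) ^ (2 * k) / ((k.factorial : ℂ) * Gamma (μ + k + 1)) =
      ∑' n, kummerCoeff μ n * z ^ n := by
  rw [← tsum_coeff_exp, ← (hasSum_besselISeries μ z).2,
    tsum_mul_tsum_eq_tsum_coeff_mul _ _ _ (summable_norm_coeff_exp z) (hasSum_besselISeries μ z).1]
  rfl

theorem kummerCoeff_summable (μ z : ℂ) : Summable fun n => kummerCoeff μ n * z ^ n := by
  have := summable_norm_sum_mul_antidiagonal_of_summable_norm (summable_norm_coeff_exp z)
    (hasSum_besselISeries μ z).1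
  refine this.of_norm.congr fun n => ?_
  rw [kummerCoeff, coeff_mul, Finset.sum_mul]
  refine Finset.sum_congr rfl fun p hp => ?_
  rw [← Finset.HasAntidiagonal.mem_antidiagonal.mp hp, pow_add]
  ring

theorem mul_cpow_of_arg_add_arg_mem {x y : ℂ} (hx : x ≠ 0) (hy : y ≠ 0)
    (h : arg x + arg y ∈ Set.Ioc (-Real.pi) Real.pi) (a : ℂ) : (x * y) ^ a = x ^ a * y ^ a := by
  rw [cpow_def_of_ne_zero (mul_ne_zero hx hy), cpow_def_of_ne_zero hx, cpow_def_of_ne_zero hy,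
    ← Complex.exp_add, Complex.log_mul hx hy h, add_mul]

theorem besselI_eq (μ z : ℂ) (hz : z ≠ 0) (hlow : -Real.pi < arg z) (hupp : arg z ≤ Real.pi / 2) :
    besselI μ z = (z / 2) ^ μ * (Complex.exp (-z) * ∑' n, kummerCoeff μ n * z ^ n) := by
  rw [← exp_mul_tsum_eq_tsum_kummerCoeff, ← mul_assoc (Complex.exp (-z)), ← Complex.exp_add,
    neg_add_cancel, Complex.exp_zero, one_mul, besselI, besselJ]
  have hz2 : z / 2 ≠ 0 := by simpa using hz
  have harg : arg (z / 2) = arg z := by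
    rw [show z / 2 = ((1 / 2 : ℝ) : ℂ) * z by push_cast; ring,
      arg_real_mul _ (by norm_num)]
  -- The bound `arg z ≤ π/2` enters here: `arg I + arg (z/2)` stays in `(-π, π]`, so the principal
  -- power splits.
  have hpow : (I * z / 2) ^ μ = Complex.exp (I * μ * Real.pi / 2) * (z / 2) ^ μ := by
    rw [mul_div_assoc, mul_cpow_of_arg_add_arg_mem I_ne_zero hz2 ?_]
    · rw [cpow_def_of_ne_zero I_ne_zero, log_I]
      ring_nf
    · rw [arg_I, harg]
      constructor <;> linarith [Real.pi_pos]
  rw [hpow, ← mul_assoc, ← mul_assoc, ← Complex.exp_add,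
    show -I * μ * Real.pi / 2 + I * μ * Real.pi / 2 = 0 by ring, Complex.exp_zero, one_mul]
  congr 1
  refine tsum_congr fun k => ?_
  rw [mul_div_assoc I, mul_pow I, pow_mul I, I_sq, ← mul_assoc, ← mul_pow]
  norm_num

end MixedBessel

end

/-! ### Gamma quotients as Taylor coefficients; series for the incomplete gamma function -/

noncomputable section

namespace MixedBessel

open Complex Filter Topology PowerSeries

theorem gammaQuotient_natCast_add_one (N : ℕ) (s : ℂ) :
    gammaQuotient (N + 1) s =
      Gamma (s + N + 1 / 2) / ((N.factorial : ℂ) * Gamma (2 * s + N + 1)) := by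
  rw [gammaQuotient]
  push_cast
  rw [Gamma_nat_eq_factorial]
  ring_nf

theorem ne_neg_nat_of_Gamma_ne_zero {s : ℂ} (h : Gamma s ≠ 0) (m : ℕ) : s ≠ -m := by
  rintro rfl
  exact h (Gamma_neg_nat_eq_zero m)

/-- Both sides satisfy the same recurrence, and Legendre duplication at `s + 1/2` settles `N = 0`.
As `Gamma` is `0` at its poles, `hs` says that `2s+1` is not a pole; this keeps the recurrence
nondegenerate. -/
theorem gammaQuotient_eq_of_Gamma_ne_zero (s : ℂ) (hs : Gamma (2 * s + 1) ≠ 0) (N : ℕ) :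
    gammaQuotient (N + 1) s = Real.sqrt Real.pi * 2 ^ (-2 * s - N) * kummerCoeff s N := by
  have hne := ne_neg_nat_of_Gamma_ne_zero hs
  rw [gammaQuotient_natCast_add_one]
  induction N with
  | zero =>
    rw [kummerCoeff_zero]
    have hleg := Gamma_mul_Gamma_add_half (s + 1 / 2)
    rw [show s + 1 / 2 + 1 / 2 = s + 1 by ring, show 2 * (s + 1 / 2) = 2 * s + 1 by ring,
      show 1 - (2 * s + 1) = -2 * s - (0 : ℕ) by push_cast; ring] at hleg
    have h1 : Gamma (s + 1) ≠ 0 := Gamma_ne_zero fun m hm => by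
      refine hne (2 * m + 1) ?_
      push_cast
      linear_combination 2 * hm
    rw [Nat.factorial_zero, ← div_eq_mul_inv, div_eq_div_iff _ h1]
    · push_cast at hleg ⊢
      rw [add_zero, add_zero]
      linear_combination hleg
    · simpa using hs
  | succ N ih =>
    have hrec := kummerCoeff_succ s N
    have ha : s + N + 1 / 2 ≠ 0 := fun h => by
      refine hne (2 * N) ?_
      push_cast
      linear_combination 2 * h
    have hb : 2 * s + N + 1 ≠ 0 := fun h => hne N (by linear_combination h)
    have hc : (N : ℂ) + 1 ≠ 0 := by exact_mod_cast N.succ_ne_zero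
    have hpow : (2 : ℂ) ^ (-2 * s - (N + 1 : ℕ)) * 2 = 2 ^ (-2 * s - N) := by
      rw [show -2 * s - N = -2 * s - (N + 1 : ℕ) + 1 by push_cast; ring,
        cpow_add _ _ two_ne_zero, cpow_one]
    have hG1 : Gamma (s + (N + 1 : ℕ) + 1 / 2) = (s + N + 1 / 2) * Gamma (s + N + 1 / 2) := by
      rw [← Gamma_add_one _ ha]
      push_cast
      ring_nf
    have hG2 : Gamma (2 * s + (N + 1 : ℕ) + 1) = (2 * s + N + 1) * Gamma (2 * s + N + 1) := by
      rw [← Gamma_add_one _ hb]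
      push_cast
      ring_nf
    rw [hG1, hG2, Nat.factorial_succ]
    push_cast
    rw [mul_mul_mul_comm, mul_div_mul_comm, ih, ← hpow, div_mul_eq_mul_div,
      div_eq_iff (mul_ne_zero hc hb)]
    push_cast
    linear_combination (-(Real.sqrt Real.pi : ℂ) * 2 ^ (-2 * s - ((N : ℂ) + 1))) * hrec

/-- The entire function `1/Γ(2s+1)` equals `1` at `s = 0`, so its zeros are isolated. -/
theorem eventually_Gamma_ne_zero (μ : ℂ) : ∀ᶠ s in 𝓝[≠] μ, Gamma (2 * s + 1) ≠ 0 := by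
  have hd : Differentiable ℂ fun s : ℂ => (Gamma (2 * s + 1))⁻¹ :=
    differentiable_one_div_Gamma.comp (by fun_prop)
  have han : AnalyticOnNhd ℂ (fun s : ℂ => (Gamma (2 * s + 1))⁻¹) Set.univ :=
    analyticOnNhd_univ_iff_differentiable.mpr hd
  rcases (han μ (Set.mem_univ _)).eventually_eq_zero_or_eventually_ne_zero with h | h
  · have h0 := han.eqOn_zero_of_preconnected_of_eventuallyEq_zero isPreconnected_univ
      (Set.mem_univ μ) h (Set.mem_univ 0)
    simp at h0
  · exact h.mono fun s hs => by simpa using hs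

theorem tendsto_gammaQuotient (μ : ℂ) (N : ℕ) :
    Tendsto (gammaQuotient (N + 1)) (𝓝[≠] μ)
      (𝓝 (Real.sqrt Real.pi * 2 ^ (-2 * μ - N) * kummerCoeff μ N)) := by
  have hc : Continuous fun s : ℂ =>
      (Real.sqrt Real.pi : ℂ) * 2 ^ (-2 * s - N) * kummerCoeff s N := by
    refine (continuous_const.mul ?_).mul (continuous_kummerCoeff N)
    exact (continuous_const_cpow (z := 2)).comp (by fun_prop)
  refine (hc.continuousAt.tendsto.mono_left nhdsWithin_le_nhds).congr' ?_
  filter_upwards [eventually_Gamma_ne_zero μ] with s hs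
  exact (gammaQuotient_eq_of_Gamma_ne_zero s hs N).symm

/-- Only a pole of the numerator can break continuity, because `1/Γ` is entire; elsewhere the
literal value is the limit. -/
theorem gammaQuotient_eq (μ : ℂ) (N : ℕ) (h : ∀ m : ℕ, μ + N + 1 / 2 ≠ -m) :
    gammaQuotient (N + 1) μ = Real.sqrt Real.pi * 2 ^ (-2 * μ - N) * kummerCoeff μ N := by
  have hc : ContinuousAt (gammaQuotient (N + 1)) μ := by
    rw [show gammaQuotient (N + 1) = fun s => Gamma (s + N + 1 / 2) *
      ((N.factorial : ℂ)⁻¹ * (Gamma (2 * s + N + 1))⁻¹) from funext fun s => by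
        rw [gammaQuotient_natCast_add_one, div_eq_mul_inv, mul_inv]]
    refine ContinuousAt.mul ?_ (continuousAt_const.mul ?_)
    · exact ContinuousAt.comp (f := fun s : ℂ => s + N + 1 / 2) (g := Gamma)
        (differentiableAt_Gamma _ h).continuousAt (by fun_prop)
    · exact (differentiable_one_div_Gamma.continuous.comp
        (by fun_prop : Continuous fun s : ℂ => 2 * s + N + 1)).continuousAt
  exact tendsto_nhds_unique (hc.tendsto.mono_left nhdsWithin_le_nhds) (tendsto_gammaQuotient μ N)

theorem sumCoeff_eq (μ : ℂ) (N : ℕ) :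
    sumCoeff (N + 1) μ = Real.sqrt Real.pi * 2 ^ (-2 * μ - N) * kummerCoeff μ N := by
  rw [sumCoeff]
  split_ifs with h
  · exact (tendsto_gammaQuotient μ N).limUnder_eq
  · refine gammaQuotient_eq μ N fun m hm => h ⟨-(N + m + 1), by lia, ?_⟩
    push_cast
    linear_combination hm

/-- The power series `∑ (-X)^m / ((ν + m) m!)`. -/
def incGammaSeries (ν : ℂ) : PowerSeries ℂ :=
  PowerSeries.mk fun m => (-1) ^ m / ((ν + m) * (m.factorial : ℂ))

theorem coeff_evalNegHom_exp (m : ℕ) :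
    coeff m (evalNegHom (PowerSeries.exp ℂ)) = (-1) ^ m / (m.factorial : ℂ) := by
  simp [evalNegHom, div_eq_mul_inv]

theorem incGammaSeries_ode (ν : ℂ) (hν : ∀ m : ℕ, ν ≠ -m) :
    C ν * incGammaSeries ν + X * d⁄dX ℂ (incGammaSeries ν) =
      evalNegHom (PowerSeries.exp ℂ) := by
  ext m
  have hm : ν + m ≠ 0 := fun h => hν m (eq_neg_of_add_eq_zero_left h)
  have hX : coeff m (X * d⁄dX ℂ (incGammaSeries ν)) = m * coeff m (incGammaSeries ν) := by
    rcases m with _ | m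
    · simp
    · rw [coeff_succ_X_mul, coeff_derivative]
      push_cast
      ring
  rw [map_add, coeff_C_mul, hX, coeff_evalNegHom_exp, ← add_mul, incGammaSeries, coeff_mk]
  field_simp

/-- Multiplying `ν g + x g' = e^{-x}` by `e^x` gives `ν y + x y' = x y + 1` for `y = e^x g`, hence
`(ν+m+1) y_{m+1} = y_m`. -/
theorem coeff_exp_mul_incGammaSeries (ν : ℂ) (hν : ∀ m : ℕ, ν ≠ -m) (m : ℕ) :
    coeff m (PowerSeries.exp ℂ * incGammaSeries ν) = Gamma ν * (Gamma (ν + 1 + m))⁻¹ := by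
  set g := incGammaSeries ν with hg
  set e := PowerSeries.exp ℂ with he
  have hode : C ν * (e * g) + X * d⁄dX ℂ (e * g) = X * (e * g) + 1 := by
    rw [← PowerSeries.exp_mul_exp_neg_eq_one (A := ℂ), ← incGammaSeries_ode ν hν,
      Derivation.leibniz, PowerSeries.derivative_exp, smul_eq_mul, smul_eq_mul]
    ring
  have hΓ := Gamma_ne_zero hν
  have hν0 : ν ≠ 0 := by simpa using hν 0
  induction m with
  | zero =>
    have hc := congrArg (coeff 0) hode
    rw [map_add, map_add, coeff_C_mul, coeff_zero_X_mul, coeff_zero_X_mul, coeff_zero_one] at hc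
    rw [Nat.cast_zero, add_zero, Gamma_add_one ν hν0]
    field_simp
    linear_combination hc
  | succ m ih =>
    have hc := congrArg (coeff (m + 1)) hode
    rw [map_add, map_add, coeff_C_mul, coeff_succ_X_mul, coeff_succ_X_mul, coeff_derivative, ih,
      coeff_one, if_neg m.succ_ne_zero, add_zero] at hc
    have hm : ν + 1 + m ≠ 0 := fun h => hν (m + 1) (by push_cast; linear_combination h)
    have hstep := one_div_Gamma_eq_self_mul_one_div_Gamma_add_one (ν + 1 + m)
    rw [hstep] at hc
    push_cast
    rw [← add_assoc]
    refine mul_left_cancel₀ hm ?_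
    linear_combination hc

theorem summable_norm_incGammaSeries (ν w : ℂ) (hν : -(1 / 2) < ν.re) :
    Summable fun m => ‖coeff m (incGammaSeries ν) * w ^ m‖ := by
  refine Summable.norm ?_
  refine Summable.of_norm_bounded_eventually_nat
    ((NormedSpace.norm_expSeries_div_summable w).mul_left 2) ?_
  filter_upwards [eventually_ge_atTop 1] with m hm
  have hm1 : (1 : ℝ) ≤ m := by exact_mod_cast hm
  have hre : 1 / 2 ≤ ‖ν + m‖ := by
    refine le_trans ?_ (re_le_norm _)
    rw [add_re, natCast_re]
    linarith
  have hinv : ‖ν + m‖⁻¹ ≤ 2 := by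
    rw [inv_le_comm₀ (by linarith) two_pos]
    linarith
  rw [incGammaSeries, coeff_mk, div_mul_eq_mul_div, norm_div, norm_mul, norm_mul, norm_pow, norm_neg,
    norm_one, one_pow, one_mul, norm_div, div_mul_eq_div_div, div_right_comm, div_eq_mul_inv _ ‖ν + m‖,
    mul_comm]
  gcongr

/-- The factor `Γ(ν)` cancels, so this form has no singular `ν`. The bound on `Re ν` leaves `ν = 0`
as the only special case, where the series is `e^w`. -/
theorem regIncGamma_eq (ν w : ℂ) (hν : -(1 / 2) < ν.re) :
    regIncGamma ν w =
      w ^ ν * (Complex.exp (-w) * ∑' m : ℕ, w ^ m * (Gamma (ν + 1 + m))⁻¹) := by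
  rw [regIncGamma]
  split_ifs with h
  · obtain ⟨n, rfl⟩ := h
    have hn : n = 0 := by
      by_contra hn
      have : (1 : ℝ) ≤ n := by exact_mod_cast Nat.one_le_iff_ne_zero.mpr hn
      simp only [neg_re, natCast_re] at hν
      linarith
    subst hn
    have hsum : ∑' m : ℕ, w ^ m * (Gamma (-((0 : ℕ) : ℂ) + 1 + m))⁻¹ = Complex.exp w := by
      rw [Complex.exp_eq_exp_ℂ, NormedSpace.exp_eq_tsum_div]
      refine tsum_congr fun m => ?_
      rw [Nat.cast_zero, neg_zero, zero_add, add_comm, Gamma_nat_eq_factorial, div_eq_mul_inv]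
    rw [hsum, ← Complex.exp_add]
    simp
  · push Not at h
    have hprod := tsum_mul_tsum_eq_tsum_coeff_mul _ _ w (summable_norm_coeff_exp w)
      (summable_norm_incGammaSeries ν w hν)
    rw [tsum_coeff_exp] at hprod
    simp only [coeff_exp_mul_incGammaSeries ν h, mul_assoc] at hprod
    rw [tsum_mul_left] at hprod
    have hser : ∑' m : ℕ, (-w) ^ m / ((ν + m) * (m.factorial : ℂ)) =
        ∑' m, coeff m (incGammaSeries ν) * w ^ m := by
      refine tsum_congr fun m => ?_
      rw [incGammaSeries, coeff_mk, neg_pow]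
      ring
    rw [lowerIncGamma, hser, mul_div_assoc]
    congr 1
    have hΓ := Gamma_ne_zero h
    have hcomm : ∑' m : ℕ, w ^ m * (Gamma (ν + 1 + m))⁻¹ =
        ∑' m : ℕ, (Gamma (ν + 1 + m))⁻¹ * w ^ m := tsum_congr fun m => mul_comm _ _
    rw [hcomm, div_eq_iff hΓ, mul_assoc, mul_comm _ (Gamma ν), ← hprod, ← mul_assoc,
      ← Complex.exp_add, neg_add_cancel, Complex.exp_zero, one_mul]

end MixedBessel

end

/-! ### Binomial series on circles of radius below one, and a majorant uniform in the radius -/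

noncomputable section

namespace MixedBessel

open Complex Filter Topology MeasureTheory intervalIntegral

theorem choose_eq_Gamma (a : ℂ) (ha : Gamma (a + 1) ≠ 0) (n : ℕ) :
    Ring.choose a n = Gamma (a + 1) * (Gamma (n + 1))⁻¹ * (Gamma (a - n + 1))⁻¹ := by
  have hd : (descPochhammer ℤ n).smeval a = Gamma (a + 1) * (Gamma (a - n + 1))⁻¹ := by
    induction n with
    | zero => simp [mul_inv_cancel₀ ha]
    | succ n ih =>
      rw [descPochhammer_succ_right, Polynomial.smeval_mul, ih,
        one_div_Gamma_eq_self_mul_one_div_Gamma_add_one (a - (n + 1 : ℕ) + 1)]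
      simp only [Polynomial.smeval_sub, Polynomial.smeval_X, Polynomial.smeval_natCast]
      push_cast
      rw [show a - ((n : ℂ) + 1) + 1 = a - n by ring]
      simp
      ring
  have hn : (n.factorial : ℂ) ≠ 0 := by exact_mod_cast n.factorial_ne_zero
  rw [Ring.descPochhammer_eq_factorial_smul_choose, nsmul_eq_mul] at hd
  rw [Gamma_nat_eq_factorial]
  field_simp
  rw [mul_comm, hd, div_eq_mul_inv]

theorem hasSum_binomial (a x : ℂ) (hx : ‖x‖ < 1) :
    HasSum (fun n : ℕ => Ring.choose a n * x ^ n) ((1 + x) ^ a) := by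
  have h := (one_add_cpow_hasFPowerSeriesOnBall_zero (a := a)).hasSum (y := x)
    (by simpa [enorm_eq_nnnorm, ← NNReal.coe_lt_coe] using hx)
  simpa [binomialSeries, FormalMultilinearSeries.coeff_ofScalars, mul_comm] using h

theorem integral_exp_int_mul_I (m : ℤ) :
    ∫ θ in (-Real.pi)..Real.pi, Complex.exp (m * θ * I) = if m = 0 then 2 * (Real.pi : ℂ) else 0 := by
  split_ifs with hm
  · subst hm
    simp only [Int.cast_zero, zero_mul, Complex.exp_zero, intervalIntegral.integral_const,
      sub_neg_eq_add]
    rw [real_smul]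
    push_cast
    ring
  · have hc : (m : ℂ) * I ≠ 0 := mul_ne_zero (by exact_mod_cast hm) I_ne_zero
    have h := integral_exp_mul_complex (a := -Real.pi) (b := Real.pi) hc
    have hper : Complex.exp (m * I * Real.pi) = Complex.exp (m * I * (-Real.pi : ℝ)) := by
      rw [Complex.exp_eq_exp_iff_exists_int]
      refine ⟨m, ?_⟩
      push_cast
      ring
    rw [hper, sub_self, zero_div] at h
    rw [← h]
    exact integral_congr fun θ _ => by ring_nf

theorem one_add_mem_slitPlane {x : ℂ} (hx : ‖x‖ < 1) : 1 + x ∈ slitPlane := by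
  refine Or.inl ?_
  have h := neg_le_of_abs_le (abs_re_le_norm x)
  rw [add_re, one_re]
  linarith

theorem norm_ofReal_mul_exp_mul_I {r : ℝ} (hr : 0 ≤ r) (θ : ℝ) :
    ‖(r : ℂ) * Complex.exp (θ * I)‖ = r := by
  rw [norm_mul, norm_exp_ofReal_mul_I, mul_one, Complex.norm_of_nonneg hr]

/-- Integrating the binomial series termwise, orthogonality keeps only the term `n = k`. -/
theorem integral_one_add_cpow_circle (a : ℂ) (ha : Gamma (a + 1) ≠ 0) (k : ℤ) {r : ℝ} (hr : 0 < r)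
    (hr1 : r < 1) :
    ∫ θ in (-Real.pi)..Real.pi,
        (1 + r * Complex.exp (θ * I)) ^ a * Complex.exp (-k * θ * I) =
      2 * Real.pi * (Gamma (a + 1) * (Gamma (k + 1))⁻¹ * (Gamma (a - k + 1))⁻¹) * (r : ℂ) ^ k := by
  have hnorm : ∀ θ : ℝ, ‖(r : ℂ) * Complex.exp (θ * I)‖ < 1 := fun θ => by
    rwa [norm_ofReal_mul_exp_mul_I hr.le]
  have hs : Summable fun n : ℕ => ‖Ring.choose a n * (r : ℂ) ^ n‖ :=
    (hasSum_binomial a r (by rwa [Complex.norm_of_nonneg hr.le])).summable.norm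
  have hexp : ∀ (n : ℕ) (θ : ℝ),
      Ring.choose a n * (r * Complex.exp (θ * I)) ^ n * Complex.exp (-k * θ * I) =
        Ring.choose a n * (r : ℂ) ^ n * Complex.exp (((n - k : ℤ) : ℂ) * θ * I) := fun n θ => by
    rw [mul_pow, ← Complex.exp_nat_mul, ← mul_assoc, mul_assoc, ← Complex.exp_add]
    push_cast
    ring_nf
  have hsum := hasSum_integral_of_dominated_convergence (μ := volume) (a := -Real.pi) (b := Real.pi)
    (F := fun (n : ℕ) (θ : ℝ) =>
      Ring.choose a n * (r * Complex.exp (θ * I)) ^ n * Complex.exp (-k * θ * I))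
    (f := fun θ => (1 + r * Complex.exp (θ * I)) ^ a * Complex.exp (-k * θ * I))
    (fun n _ => ‖Ring.choose a n * (r : ℂ) ^ n‖)
    (fun n => (by fun_prop : Continuous fun θ : ℝ =>
      Ring.choose a n * (r * Complex.exp (θ * I)) ^ n *
        Complex.exp (-k * θ * I)).aestronglyMeasurable)
    (fun n => ae_of_all _ fun θ _ => by
      rw [hexp, norm_mul, show (((n - k : ℤ) : ℂ) * θ * I) = (((n - k : ℤ) * θ : ℝ) : ℂ) * I by
        push_cast; ring, norm_exp_ofReal_mul_I, mul_one])
    (ae_of_all _ fun _ _ => hs) intervalIntegrable_const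
    (ae_of_all _ fun θ _ => (hasSum_binomial a _ (hnorm θ)).mul_right _)
  have hterm : ∀ n : ℕ, ∫ θ in (-Real.pi)..Real.pi,
      Ring.choose a n * (r * Complex.exp (θ * I)) ^ n * Complex.exp (-k * θ * I) =
        if (n : ℤ) = k then
          2 * Real.pi * (Gamma (a + 1) * (Gamma (k + 1))⁻¹ * (Gamma (a - k + 1))⁻¹) * (r : ℂ) ^ k
        else 0 := fun n => by
    simp only [hexp]
    rw [intervalIntegral.integral_const_mul, integral_exp_int_mul_I, choose_eq_Gamma a ha]
    by_cases h : (n : ℤ) = k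
    · subst h
      simp only [sub_self, if_true, Int.cast_natCast, zpow_natCast]
      ring
    · rw [if_neg (sub_ne_zero.mpr h), if_neg h, mul_zero]
  simp only [hterm] at hsum
  rcases le_or_gt 0 k with hk | hk
  · lift k to ℕ using hk
    refine hsum.unique ?_
    simp only [Int.natCast_inj]
    exact hasSum_ite_eq k _
  -- For negative `k` no term survives, and the right side vanishes because `k + 1` is a pole of
  -- `Γ`.
  · have hz : ∀ n : ℕ, ¬ (n : ℤ) = k := fun n => by lia
    simp only [hz, if_false] at hsum
    rw [hsum.unique hasSum_zero]
    obtain ⟨m, hm⟩ := Int.eq_negSucc_of_lt_zero hk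
    have : (k : ℂ) + 1 = -(m : ℂ) := by
      rw [hm]
      push_cast
      ring
    rw [this, Gamma_neg_nat_eq_zero]
    simp

/-- The norm is at least `cos(θ/2)` for every `r ≥ 0`, and Jordan's inequality bounds that cosine
below. -/
theorem one_sub_abs_div_pi_le_norm {r θ : ℝ} (hr : 0 ≤ r) (hθ : |θ| ≤ Real.pi) :
    1 - |θ| / Real.pi ≤ ‖1 + (r : ℂ) * Complex.exp (θ * I)‖ := by
  have hcos : 1 - |θ| / Real.pi ≤ Real.cos (θ / 2) := by
    have h := Real.one_sub_mul_le_cos (x := |θ| / 2) (by positivity) (by linarith)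
    rw [← Real.cos_abs (θ / 2), abs_div, abs_two]
    calc 1 - |θ| / Real.pi = 1 - 2 / Real.pi * (|θ| / 2) := by ring
      _ ≤ _ := h
  refine hcos.trans ?_
  refine Real.le_sqrt_of_sq_le ?_ |>.trans_eq (Complex.norm_eq_sqrt_sq_add_sq _).symm
  have hre : (1 + (r : ℂ) * Complex.exp (θ * I)).re = 1 + r * Real.cos θ := by
    rw [add_re, re_ofReal_mul, exp_ofReal_mul_I_re, one_re]
  have him : (1 + (r : ℂ) * Complex.exp (θ * I)).im = r * Real.sin θ := by
    rw [add_im, im_ofReal_mul, exp_ofReal_mul_I_im, one_im, zero_add]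
  rw [hre, him, Real.cos_sq, mul_div_cancel₀ _ two_ne_zero]
  have hsc := Real.sin_sq_add_cos_sq θ
  have hc1 := Real.neg_one_le_cos θ
  have hexpand : (1 + r * Real.cos θ) ^ 2 + (r * Real.sin θ) ^ 2 =
      (r + Real.cos θ) ^ 2 + (1 - Real.cos θ ^ 2) := by
    linear_combination r ^ 2 * hsc
  rw [hexpand]
  -- With `c = cos θ`: if `c ≥ 0` the squared norm is at least `1`; if `c < 0` it is at least `1 -
  -- c² = (1-c)(1+c) ≥ (1+c)/2`.
  rcases le_or_gt 0 (Real.cos θ) with hc | hc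
  · nlinarith [mul_nonneg hr hc, Real.cos_le_one θ]
  · nlinarith [sq_nonneg (r + Real.cos θ)]

/-- An integrable majorant of `|1 + r e^{iθ}|^β` on `(-π, π)`. -/
def edgeMajorant (β θ : ℝ) : ℝ :=
  Real.pi ^ (-β) * ((Real.pi - θ) ^ β + (Real.pi + θ) ^ β)

theorem intervalIntegrable_edgeMajorant {β : ℝ} (hβ : -1 < β) :
    IntervalIntegrable (edgeMajorant β) volume (-Real.pi) Real.pi := by
  have h := intervalIntegral.intervalIntegrable_rpow' (a := 0) (b := 2 * Real.pi) hβ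
  refine IntervalIntegrable.const_mul (IntervalIntegrable.add ?_ ?_) _
  · have := (h.comp_sub_left Real.pi).symm
    rwa [sub_zero, show Real.pi - 2 * Real.pi = -Real.pi by ring] at this
  · have := h.comp_add_left Real.pi
    rwa [zero_sub, show 2 * Real.pi - Real.pi = Real.pi by ring] at this

theorem rpow_le_edgeMajorant {β θ : ℝ} (hθ : |θ| < Real.pi) :
    (1 - |θ| / Real.pi) ^ β ≤ edgeMajorant β θ := by
  have hpi := Real.pi_pos
  obtain ⟨h1, h2⟩ := abs_lt.mp hθ
  have hA : 0 ≤ (Real.pi - θ) ^ β := Real.rpow_nonneg (by linarith) _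
  have hB : 0 ≤ (Real.pi + θ) ^ β := Real.rpow_nonneg (by linarith) _
  rw [one_sub_div hpi.ne', Real.div_rpow (by linarith) hpi.le, div_eq_mul_inv,
    ← Real.rpow_neg hpi.le, mul_comm, edgeMajorant]
  gcongr
  rcases abs_cases θ with ⟨h, _⟩ | ⟨h, _⟩ <;> rw [h]
  · linarith
  · rw [sub_neg_eq_add]
    linarith

/-- The exponent splits into `min (Re a) 0`, controlled by the lower bound on the norm, and a
nonnegative rest, controlled by the norm being at most `2`. The argument contributes at most
`e^{π|Im a|}`. -/
theorem norm_one_add_cpow_le (a : ℂ) {r θ : ℝ} (hr : 0 ≤ r) (hr1 : r ≤ 1) (hθ : |θ| < Real.pi) :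
    ‖(1 + (r : ℂ) * Complex.exp (θ * I)) ^ a‖ ≤
      Real.exp (Real.pi * |a.im|) * 2 ^ (a.re - min a.re 0) * edgeMajorant (min a.re 0) θ := by
  set x := 1 + (r : ℂ) * Complex.exp (θ * I) with hx
  have hlow : 1 - |θ| / Real.pi ≤ ‖x‖ := one_sub_abs_div_pi_le_norm hr hθ.le
  have hpos : 0 < 1 - |θ| / Real.pi := by
    rw [sub_pos, div_lt_one Real.pi_pos]
    exact hθ
  have hup : ‖x‖ ≤ 2 := by
    refine (norm_add_le _ _).trans ?_
    rw [norm_one, norm_ofReal_mul_exp_mul_I hr]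
    linarith
  have hxpos : 0 < ‖x‖ := hpos.trans_le hlow
  have hexp : (Real.exp (arg x * a.im))⁻¹ ≤ Real.exp (Real.pi * |a.im|) := by
    rw [← Real.exp_neg]
    refine Real.exp_le_exp.mpr ((neg_le_abs _).trans ?_)
    rw [abs_mul]
    gcongr
    exact abs_arg_le_pi x
  have hpow : ‖x‖ ^ a.re ≤ 2 ^ (a.re - min a.re 0) * edgeMajorant (min a.re 0) θ := by
    rw [show ‖x‖ ^ a.re = ‖x‖ ^ (a.re - min a.re 0) * ‖x‖ ^ (min a.re 0) by
      rw [← Real.rpow_add hxpos, sub_add_cancel]]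
    gcongr
    · exact sub_nonneg.mpr (min_le_left _ _)
    · exact (Real.rpow_le_rpow_of_nonpos hpos hlow (min_le_right _ _)).trans
        (rpow_le_edgeMajorant hθ)
  refine (norm_cpow_le x a).trans ?_
  rw [div_eq_mul_inv, mul_comm, mul_assoc]
  gcongr

end MixedBessel

end

/-! ### Passage to the unit circle and Cauchy's cosine integral -/

noncomputable section

namespace MixedBessel

open Complex Filter Topology MeasureTheory intervalIntegral

theorem ae_abs_lt_pi : ∀ᵐ θ : ℝ, θ ∈ Set.uIoc (-Real.pi) Real.pi → |θ| < Real.pi := by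
  filter_upwards [Measure.ae_ne volume Real.pi] with θ hne hθ
  rw [Set.uIoc_of_le (by linarith [Real.pi_pos])] at hθ
  exact abs_lt.mpr ⟨hθ.1, lt_of_le_of_ne hθ.2 hne⟩

theorem one_add_cos_pos {θ : ℝ} (hθ : |θ| < Real.pi) : 0 < 1 + Real.cos θ := by
  have h : 0 < Real.cos (θ / 2) :=
    Real.cos_pos_of_mem_Ioo ⟨by linarith [(abs_lt.mp hθ).1], by linarith [(abs_lt.mp hθ).2]⟩
  have h2 := Real.cos_sq (θ / 2)
  rw [mul_div_cancel₀ _ two_ne_zero] at h2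
  nlinarith [pow_pos h 2]

theorem one_add_exp_mem_slitPlane {θ : ℝ} (hθ : |θ| < Real.pi) :
    1 + Complex.exp (θ * I) ∈ slitPlane := by
  refine Or.inl ?_
  rw [add_re, one_re, exp_ofReal_mul_I_re]
  exact one_add_cos_pos hθ

theorem continuous_one_add_cpow_circle (a : ℂ) {r : ℝ} (hr : 0 ≤ r) (hr1 : r < 1) :
    Continuous fun θ : ℝ => (1 + (r : ℂ) * Complex.exp (θ * I)) ^ a := by
  refine Continuous.cpow (by fun_prop) continuous_const fun θ => one_add_mem_slitPlane ?_
  rwa [norm_ofReal_mul_exp_mul_I hr]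

theorem intervalIntegrable_cpow_majorant {a : ℂ} (ha : -1 < a.re) (C : ℝ) :
    IntervalIntegrable (fun θ => C * edgeMajorant (min a.re 0) θ) volume (-Real.pi) Real.pi :=
  (intervalIntegrable_edgeMajorant (lt_min ha (by norm_num))).const_mul C

theorem intervalIntegrable_one_add_exp_cpow {a : ℂ} (ha : -1 < a.re) :
    IntervalIntegrable (fun θ : ℝ => (1 + Complex.exp (θ * I)) ^ a) volume
      (-Real.pi) Real.pi := by
  refine (intervalIntegrable_cpow_majorant ha
    (Real.exp (Real.pi * |a.im|) * 2 ^ (a.re - min a.re 0))).mono_fun'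
    (by fun_prop : Measurable _).aestronglyMeasurable ?_
  rw [EventuallyLE, ae_restrict_iff' measurableSet_uIoc]
  filter_upwards [ae_abs_lt_pi] with θ hθ hmem
  simpa using norm_one_add_cpow_le a zero_le_one le_rfl (hθ hmem)

/-- Limit `r → 1⁻` under the majorant, which is integrable exactly because `Re a > -1`. -/
theorem integral_one_add_exp_cpow {a : ℂ} (ha : -1 < a.re) (k : ℤ) :
    ∫ θ in (-Real.pi)..Real.pi, (1 + Complex.exp (θ * I)) ^ a * Complex.exp (-k * θ * I) =
      2 * Real.pi * (Gamma (a + 1) * (Gamma (k + 1))⁻¹ * (Gamma (a - k + 1))⁻¹) := by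
  have hΓ : Gamma (a + 1) ≠ 0 := Gamma_ne_zero_of_re_pos (by rw [add_re, one_re]; linarith)
  have hr : ∀ᶠ r : ℝ in 𝓝[<] 1, 0 < r ∧ r < 1 := Ioo_mem_nhdsLT zero_lt_one
  have hL : Tendsto (fun r : ℝ => ∫ θ in (-Real.pi)..Real.pi,
      (1 + (r : ℂ) * Complex.exp (θ * I)) ^ a * Complex.exp (-k * θ * I)) (𝓝[<] 1)
      (𝓝 (∫ θ in (-Real.pi)..Real.pi,
        (1 + Complex.exp (θ * I)) ^ a * Complex.exp (-k * θ * I))) := by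
    refine intervalIntegral.tendsto_integral_filter_of_dominated_convergence _ ?_ ?_
      (intervalIntegrable_cpow_majorant ha
        (Real.exp (Real.pi * |a.im|) * 2 ^ (a.re - min a.re 0))) ?_
    · filter_upwards [hr] with r hr
      exact ((continuous_one_add_cpow_circle a hr.1.le hr.2).mul
        (by fun_prop)).aestronglyMeasurable
    · filter_upwards [hr] with r hr
      filter_upwards [ae_abs_lt_pi] with θ hθ hmem
      rw [norm_mul, show -(k : ℂ) * θ * I = ((-k * θ : ℝ) : ℂ) * I by push_cast; ring,
        norm_exp_ofReal_mul_I, mul_one]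
      exact norm_one_add_cpow_le a hr.1.le hr.2.le (hθ hmem)
    · filter_upwards [ae_abs_lt_pi] with θ hθ hmem
      refine Tendsto.mul_const _ ?_
      have hc : ContinuousAt (fun r : ℝ => (1 + (r : ℂ) * Complex.exp (θ * I)) ^ a) 1 := by
        refine ContinuousAt.cpow (by fun_prop) continuousAt_const ?_
        simpa using one_add_exp_mem_slitPlane (hθ hmem)
      simpa using hc.tendsto.mono_left nhdsWithin_le_nhds
  have hR : Tendsto (fun r : ℝ => 2 * Real.pi *
      (Gamma (a + 1) * (Gamma (k + 1))⁻¹ * (Gamma (a - k + 1))⁻¹) * (r : ℂ) ^ k) (𝓝[<] 1)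
      (𝓝 (2 * Real.pi * (Gamma (a + 1) * (Gamma (k + 1))⁻¹ * (Gamma (a - k + 1))⁻¹))) := by
    have hc : ContinuousAt (fun r : ℝ => 2 * Real.pi *
        (Gamma (a + 1) * (Gamma (k + 1))⁻¹ * (Gamma (a - k + 1))⁻¹) * (r : ℂ) ^ k) 1 :=
      continuousAt_const.mul (continuous_ofReal.continuousAt.zpow₀ k (Or.inl (by simp)))
    simpa using hc.tendsto.mono_left nhdsWithin_le_nhds
  refine tendsto_nhds_unique hL (hR.congr' ?_)
  filter_upwards [hr] with r hr
  exact (integral_one_add_cpow_circle a hΓ k hr.1 hr.2).symm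

/-- Here `1 + e^{iθ} = 2 cos(θ/2) e^{iθ/2}` with `|θ/2| < π/2`, so the logarithm is principal, and
`2(1 + cos θ) = (2 cos(θ/2))²`. -/
theorem one_add_exp_cpow (s : ℂ) {θ : ℝ} (hθ : |θ| < Real.pi) :
    (1 + Complex.exp (θ * I)) ^ (2 * s) =
      2 ^ s * ((1 + Real.cos θ : ℝ) : ℂ) ^ s * Complex.exp (s * θ * I) := by
  obtain ⟨h1, h2⟩ := abs_lt.mp hθ
  have hpos := one_add_cos_pos hθ
  have hcos : 0 < Real.cos (θ / 2) := Real.cos_pos_of_mem_Ioo ⟨by linarith, by linarith⟩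
  have hsq : 2 * (1 + Real.cos θ) = (2 * Real.cos (θ / 2)) ^ 2 := by
    have h := Real.cos_sq (θ / 2)
    rw [mul_div_cancel₀ _ two_ne_zero] at h
    linear_combination (-4) * h
  have hexp : 1 + Complex.exp (θ * I) =
      Complex.exp (Real.log (2 * Real.cos (θ / 2)) + θ / 2 * I) := by
    rw [Complex.exp_add, ← ofReal_exp, Real.exp_log (by positivity)]
    push_cast
    rw [Complex.two_cos, add_mul, ← Complex.exp_add, ← Complex.exp_add]
    ring_nf
    simp
    ring
  have hlog : Complex.log (1 + Complex.exp (θ * I)) =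
      Real.log (2 * Real.cos (θ / 2)) + θ / 2 * I := by
    rw [hexp, Complex.log_exp]
    · simp
      linarith
    · simp
      linarith
  have h2s : (2 : ℂ) ^ s * ((1 + Real.cos θ : ℝ) : ℂ) ^ s =
      Complex.exp (2 * s * Real.log (2 * Real.cos (θ / 2))) := by
    rw [show (2 : ℂ) = ((2 : ℝ) : ℂ) by simp, ← mul_cpow_ofReal_nonneg two_pos.le hpos.le,
      ← ofReal_mul, hsq, cpow_def_of_ne_zero (by exact_mod_cast (by positivity)),
      ← ofReal_log (by positivity), Real.log_pow]
    push_cast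
    ring_nf
  rw [h2s, ← Complex.exp_add,
    cpow_def_of_ne_zero (slitPlane_ne_zero (one_add_exp_mem_slitPlane hθ)), hlog]
  ring_nf

theorem one_add_cos_cpow (s : ℂ) {θ : ℝ} (hθ : |θ| < Real.pi) :
    ((1 + Real.cos θ : ℝ) : ℂ) ^ s =
      2 ^ (-s) * Complex.exp (-(s * θ * I)) * (1 + Complex.exp (θ * I)) ^ (2 * s) := by
  have h2 : (2 : ℂ) ^ (-s) * 2 ^ s = 1 := by
    rw [← cpow_add _ _ two_ne_zero, neg_add_cancel, cpow_zero]
  have he : Complex.exp (-(s * θ * I)) * Complex.exp (s * θ * I) = 1 := by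
    rw [← Complex.exp_add, neg_add_cancel, Complex.exp_zero]
  rw [one_add_exp_cpow s hθ]
  linear_combination
    (-(Complex.exp (-(s * θ * I)) * Complex.exp (s * θ * I) * ((1 + Real.cos θ : ℝ) : ℂ) ^ s)) * h2 -
      ((1 + Real.cos θ : ℝ) : ℂ) ^ s * he

theorem two_mul_re_gt {s : ℂ} (hs : -(1 / 2) < s.re) : -1 < (2 * s).re := by
  simp only [mul_re, re_ofNat, im_ofNat, zero_mul, sub_zero]
  linarith

theorem intervalIntegrable_one_add_cos_cpow {s : ℂ} (hs : -(1 / 2) < s.re) :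
    IntervalIntegrable (fun θ : ℝ => ((1 + Real.cos θ : ℝ) : ℂ) ^ s) volume
      (-Real.pi) Real.pi := by
  refine ((intervalIntegrable_one_add_exp_cpow (two_mul_re_gt hs)).continuousOn_mul
    (g := fun θ : ℝ => 2 ^ (-s) * Complex.exp (-(s * θ * I))) (by fun_prop)).congr_ae ?_
  rw [EventuallyEq, ae_restrict_iff' measurableSet_uIoc]
  filter_upwards [ae_abs_lt_pi] with θ hθ hmem
  exact (one_add_cos_cpow s (hθ hmem)).symm

theorem integral_one_add_cos_cpow_mul_exp {s : ℂ} (hs : -(1 / 2) < s.re) (k : ℤ) :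
    ∫ θ in (-Real.pi)..Real.pi,
        ((1 + Real.cos θ : ℝ) : ℂ) ^ s * Complex.exp ((s - k) * θ * I) =
      2 ^ (-s) *
        (2 * Real.pi * (Gamma (2 * s + 1) * (Gamma (k + 1))⁻¹ * (Gamma (2 * s - k + 1))⁻¹)) := by
  rw [← integral_one_add_exp_cpow (two_mul_re_gt hs) k, ← intervalIntegral.integral_const_mul]
  refine intervalIntegral.integral_congr_ae ?_
  filter_upwards [ae_abs_lt_pi] with θ hθ hmem
  rw [one_add_cos_cpow s (hθ hmem),
    show Complex.exp (-k * θ * I) = Complex.exp (-(s * θ * I)) * Complex.exp ((s - k) * θ * I) by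
      rw [← Complex.exp_add]; ring_nf]
  ring

/-- Folding `(-π, π)` onto `(0, π)` turns the exponential into a cosine, as `1 + cos θ` is even. -/
theorem integral_one_add_cos_cpow_mul_cos {s : ℂ} (hs : -(1 / 2) < s.re) (k : ℤ) :
    ∫ θ in (0 : ℝ)..Real.pi,
        ((1 + Real.cos θ : ℝ) : ℂ) ^ s * Complex.cos ((s - k) * θ) =
      2 ^ (-s) *
        (Real.pi * (Gamma (2 * s + 1) * (Gamma (k + 1))⁻¹ * (Gamma (2 * s - k + 1))⁻¹)) := by
  have hpi := Real.pi_pos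
  set F : ℝ → ℂ := fun θ =>
    ((1 + Real.cos θ : ℝ) : ℂ) ^ s * Complex.exp ((s - k) * θ * I) with hF
  have hint : IntervalIntegrable F volume (-Real.pi) Real.pi :=
    (intervalIntegrable_one_add_cos_cpow hs).mul_continuousOn (by fun_prop)
  have hneg : IntervalIntegrable F volume (-Real.pi) 0 :=
    hint.mono_set (Set.uIcc_subset_uIcc_left (by rw [Set.mem_uIcc]; left; constructor <;> linarith))
  have hpos : IntervalIntegrable F volume 0 Real.pi :=
    hint.mono_set (Set.uIcc_subset_uIcc_right (by rw [Set.mem_uIcc]; left; constructor <;> linarith))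
  have hpos' : IntervalIntegrable (fun θ => F (-θ)) volume 0 Real.pi := by
    simpa using (hneg.comp_sub_left 0).symm
  have hsplit := integral_add_adjacent_intervals hneg hpos
  have hflip := intervalIntegral.integral_comp_neg (a := 0) (b := Real.pi) F
  rw [neg_zero] at hflip
  rw [← hflip, ← integral_add hpos' hpos, integral_one_add_cos_cpow_mul_exp hs] at hsplit
  have hcongr : ∫ θ in (0 : ℝ)..Real.pi, (F (-θ) + F θ) = ∫ θ in (0 : ℝ)..Real.pi,
      2 * (((1 + Real.cos θ : ℝ) : ℂ) ^ s * Complex.cos ((s - k) * θ)) := by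
    refine integral_congr fun θ _ => ?_
    simp only [hF]
    rw [Real.cos_neg, mul_left_comm, Complex.two_cos, ofReal_neg]
    ring_nf
  rw [hcongr, intervalIntegral.integral_const_mul] at hsplit
  linear_combination hsplit / 2

end MixedBessel

end

/-! ### Termwise integration of the integrand and matching of coefficients -/

noncomputable section

namespace MixedBessel

open Complex Filter Topology MeasureTheory intervalIntegral

/-- The integrand of the integral representation. -/
def besselIntegrand (μ z : ℂ) (θ : ℝ) : ℂ :=
  Complex.exp (z * Complex.cos θ) * regIncGamma (fracPart μ) (z * (1 + Complex.cos θ)) *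
    Complex.cos (μ * θ)

theorem mul_one_add_cos_cpow {z : ℂ} (hz : z ≠ 0) {θ : ℝ} (hθ : |θ| < Real.pi) (ν : ℂ) :
    (z * (1 + Complex.cos θ)) ^ ν = z ^ ν * ((1 + Real.cos θ : ℝ) : ℂ) ^ ν := by
  have hpos := one_add_cos_pos hθ
  rw [show (1 : ℂ) + Complex.cos θ = ((1 + Real.cos θ : ℝ) : ℂ) by push_cast; rfl]
  refine mul_cpow_of_arg_add_arg_mem hz (by exact_mod_cast hpos.ne') ?_ ν
  rw [arg_ofReal_of_nonneg hpos.le, add_zero]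
  exact arg_mem_Ioc z

/-- The exponentials `e^{z cos θ}` and `e^{-z(1+cos θ)}` combine to `e^{-z}`, free of `θ`; only
`(1+cos θ)^ν` can be singular, at `θ = π`. -/
theorem besselIntegrand_eq {μ z : ℂ} (hz : z ≠ 0) {θ : ℝ} (hθ : |θ| < Real.pi) :
    besselIntegrand μ z θ = ((1 + Real.cos θ : ℝ) : ℂ) ^ fracPart μ *
      (z ^ fracPart μ * Complex.exp (-z) * Complex.cos (μ * θ) *
        ∑' m : ℕ, (z * (1 + Complex.cos θ)) ^ m * (Gamma (fracPart μ + 1 + m))⁻¹) := by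
  rw [besselIntegrand, regIncGamma_eq _ _ (fracPart_re_mem μ).1, mul_one_add_cos_cpow hz hθ,
    show Complex.exp (-z) = Complex.exp (z * Complex.cos θ) *
      Complex.exp (-(z * (1 + Complex.cos θ))) by rw [← Complex.exp_add]; ring_nf]
  ring

theorem norm_one_add_cos_le_two (θ : ℝ) : ‖1 + Complex.cos θ‖ ≤ 2 := by
  rw [← ofReal_cos]
  refine (norm_add_le _ _).trans ?_
  rw [norm_one, norm_real, Real.norm_eq_abs]
  linarith [Real.abs_cos_le_one θ]

theorem norm_incGamma_term_le (ν z : ℂ) (θ : ℝ) (m : ℕ) :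
    ‖(z * (1 + Complex.cos θ)) ^ m * (Gamma (ν + 1 + m))⁻¹‖ ≤
      ‖(z * 2) ^ m * (Gamma (ν + 1 + m))⁻¹‖ := by
  rw [norm_mul, norm_mul, norm_pow, norm_pow, norm_mul, norm_mul]
  gcongr
  simpa using norm_one_add_cos_le_two θ

theorem intervalIntegrable_one_add_cos_cpow_zero_pi {s : ℂ} (hs : -(1 / 2) < s.re) :
    IntervalIntegrable (fun θ : ℝ => ((1 + Real.cos θ : ℝ) : ℂ) ^ s) volume 0 Real.pi :=
  (intervalIntegrable_one_add_cos_cpow hs).mono_set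
    (Set.uIcc_subset_uIcc_right
      (Set.mem_uIcc.mpr (Or.inl ⟨by linarith [Real.pi_pos], Real.pi_pos.le⟩)))

theorem ae_abs_lt_pi_zero_pi : ∀ᵐ θ : ℝ, θ ∈ Set.uIoc 0 Real.pi → |θ| < Real.pi := by
  have hpi := Real.pi_pos
  filter_upwards [ae_abs_lt_pi] with θ h hθ
  refine h ?_
  rw [Set.uIoc_of_le (by linarith)] at hθ ⊢
  exact ⟨by linarith [hθ.1], hθ.2⟩

theorem intervalIntegrable_besselIntegrand {μ z : ℂ} (hz : z ≠ 0) :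
    IntervalIntegrable (besselIntegrand μ z) volume 0 Real.pi := by
  have hcont : Continuous fun θ : ℝ => z ^ fracPart μ * Complex.exp (-z) * Complex.cos (μ * θ) *
      ∑' m : ℕ, (z * (1 + Complex.cos θ)) ^ m * (Gamma (fracPart μ + 1 + m))⁻¹ := by
    refine Continuous.mul (by fun_prop) ?_
    exact continuous_tsum (fun m => by fun_prop)
      (summable_norm_pow_mul_inv_Gamma (fracPart μ + 1) (z * 2))
      fun m θ => norm_incGamma_term_le _ z θ m
  refine ((intervalIntegrable_one_add_cos_cpow_zero_pi (fracPart_re_mem μ).1).mul_continuousOn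
    hcont.continuousOn).congr_ae ?_
  rw [EventuallyEq, ae_restrict_iff' measurableSet_uIoc]
  filter_upwards [ae_abs_lt_pi_zero_pi] with θ hθ hmem
  exact (besselIntegrand_eq hz (hθ hmem)).symm

theorem fracPart_add_nearestInt (μ : ℂ) : fracPart μ + nearestInt μ.re = μ := by
  rw [fracPart]
  ring

/-- Integrating the `m`-th term of the expansion of the integrand. -/
theorem integral_besselIntegrand_term {μ : ℂ} (m : ℕ) :
    (Gamma (fracPart μ + 1 + m))⁻¹ * ∫ θ in (0 : ℝ)..Real.pi,
      ((1 + Real.cos θ : ℝ) : ℂ) ^ (fracPart μ + m) * Complex.cos (μ * θ) =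
    Real.pi / Real.sqrt Real.pi * 2 ^ (fracPart μ + m) *
      (Gamma (fracPart μ + m + 1 / 2) * (Gamma ((m - nearestInt μ.re : ℤ) + 1))⁻¹ *
        (Gamma (fracPart μ + m + μ + 1))⁻¹) := by
  set ν := fracPart μ with hν
  have hμ : ν + nearestInt μ.re = μ := fracPart_add_nearestInt μ
  set n := nearestInt μ.re with hn
  have hre : -(1 / 2) < (ν + m).re := by
    have h := (fracPart_re_mem μ).1
    rw [add_re, natCast_re]
    have : (0 : ℝ) ≤ m := m.cast_nonneg
    linarith
  -- The choice `s = ν + m`, `k = m - n` makes `s - k = μ`. Duplication then cancels `Γ(ν+m+1)`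
  -- against `Γ(2(ν+m)+1)`.
  have h := integral_one_add_cos_cpow_mul_cos hre (m - n)
  rw [show ν + m - ((m - n : ℤ) : ℂ) = μ by rw [← hμ]; push_cast; ring,
    show 2 * (ν + m) - ((m - n : ℤ) : ℂ) + 1 = ν + m + μ + 1 by rw [← hμ]; push_cast; ring] at h
  have hdup := Gamma_mul_Gamma_add_half (ν + m + 1 / 2)
  rw [show ν + m + 1 / 2 + 1 / 2 = ν + m + 1 by ring,
    show 2 * (ν + m + 1 / 2) = 2 * (ν + m) + 1 by ring,
    show (1 : ℂ) - (2 * (ν + m) + 1) = -(ν + m) + -(ν + m) by ring,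
    cpow_add _ _ two_ne_zero] at hdup
  have hΓ : Gamma (ν + m + 1) ≠ 0 := by
    refine Gamma_ne_zero_of_re_pos ?_
    rw [add_re, one_re]
    linarith
  have hpow : (2 : ℂ) ^ (-(ν + m)) * 2 ^ (ν + m) = 1 := by
    rw [← cpow_add _ _ two_ne_zero, neg_add_cancel, cpow_zero]
  have hsqrt : (Real.sqrt Real.pi : ℂ) ≠ 0 := by
    exact_mod_cast (Real.sqrt_pos.mpr Real.pi_pos).ne'
  have hG : (Gamma (ν + m + 1))⁻¹ * (2 ^ (-(ν + m)) * Gamma (2 * (ν + m) + 1)) =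
      (Real.sqrt Real.pi : ℂ)⁻¹ * 2 ^ (ν + m) * Gamma (ν + m + 1 / 2) := by
    generalize Gamma (ν + m + 1 / 2) = A at hdup ⊢
    generalize Gamma (2 * (ν + m) + 1) = B at hdup ⊢
    field_simp
    linear_combination (-(2 : ℂ) ^ (ν + m)) * hdup -
      B * 2 ^ (-(ν + m)) * Real.sqrt Real.pi * hpow
  rw [h, show ν + 1 + m = ν + m + 1 by ring]
  linear_combination Real.pi * (Gamma ((m - n : ℤ) + 1))⁻¹ * (Gamma (ν + m + μ + 1))⁻¹ * hG

/-- The terms `a_k z^k` of a power series, extended by zero to negative `k`. -/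
def intExtend (f : ℕ → ℂ) (k : ℤ) : ℂ := if 0 ≤ k then f k.toNat else 0

theorem two_mul_cpow {z : ℂ} (hz : z ≠ 0) (a : ℂ) : (2 * z) ^ a = 2 ^ a * z ^ a := by
  refine mul_cpow_of_arg_add_arg_mem two_ne_zero hz ?_ a
  rw [show (2 : ℂ) = ((2 : ℝ) : ℂ) by simp, arg_ofReal_of_nonneg two_pos.le, zero_add]
  exact arg_mem_Ioc z

theorem div_two_cpow {z : ℂ} (hz : z ≠ 0) (a : ℂ) : (z / 2) ^ a = z ^ a * 2 ^ (-a) := by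
  have h := two_mul_cpow (z := z / 2) (by simpa using hz) a
  have h2 : (2 : ℂ) ^ (-a) * 2 ^ a = 1 := by
    rw [← cpow_add _ _ two_ne_zero, neg_add_cancel, cpow_zero]
  rw [mul_div_cancel₀ _ two_ne_zero] at h
  linear_combination (-(2 : ℂ) ^ (-a)) * h - (z / 2) ^ a * h2

theorem besselIntegrand_coeff {μ z : ℂ} (hz : z ≠ 0) (m : ℕ) :
    z ^ fracPart μ * z ^ m * (Real.pi / Real.sqrt Real.pi * 2 ^ (fracPart μ + m) *
      (Gamma (fracPart μ + m + 1 / 2) * (Gamma ((m - nearestInt μ.re : ℤ) + 1))⁻¹ *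
        (Gamma (fracPart μ + m + μ + 1))⁻¹)) =
    Real.pi * (z / 2) ^ μ *
      intExtend (fun k => kummerCoeff μ k * z ^ k) (m - nearestInt μ.re) := by
  have hμ : fracPart μ + nearestInt μ.re = μ := fracPart_add_nearestInt μ
  have hre : -(1 / 2) < (fracPart μ + m).re := by
    have h := (fracPart_re_mem μ).1
    rw [add_re, natCast_re]
    have : (0 : ℝ) ≤ m := m.cast_nonneg
    linarith
  set ν := fracPart μ with hν
  set n := nearestInt μ.re with hn
  rw [intExtend]
  split_ifs with hk
  · obtain ⟨k, hk⟩ := Int.eq_ofNat_of_zero_le hk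
    have hνm : ν + m = μ + k := by
      have : (m : ℂ) - n = k := by exact_mod_cast hk
      linear_combination this + hμ
    rw [hk, Int.toNat_natCast, ← cpow_natCast z m, ← cpow_add _ _ hz, Int.cast_natCast, hνm]
    rw [hνm] at hre
    -- `Re (μ + k) = Re (ν + m) > -1/2` keeps the numerator off its poles, so no limiting form is
    -- needed.
    have hq := gammaQuotient_eq μ k fun p hp => by
      have := congrArg re hp
      simp only [add_re, natCast_re, neg_re] at this hre
      have hp0 : (0 : ℝ) ≤ p := p.cast_nonneg
      norm_num at this
      linarith
    rw [gammaQuotient_natCast_add_one, div_eq_mul_inv, mul_inv, ← Gamma_nat_eq_factorial,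
      show 2 * μ + k + 1 = μ + k + μ + 1 by ring] at hq
    have hpow : (2 : ℂ) ^ (μ + k) * 2 ^ (-2 * μ - k) = 2 ^ (-μ) := by
      rw [← cpow_add _ _ two_ne_zero]
      ring_nf
    have hsqrt : (Real.sqrt Real.pi : ℂ) ≠ 0 := by
      exact_mod_cast (Real.sqrt_pos.mpr Real.pi_pos).ne'
    rw [mul_assoc (Gamma _), hq, div_two_cpow hz, ← hpow, cpow_add _ _ hz, cpow_natCast]
    field_simp
  · obtain ⟨p, hp⟩ := Int.eq_negSucc_of_lt_zero (not_le.mp hk)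
    have : ((m - n : ℤ) : ℂ) + 1 = -(p : ℂ) := by
      rw [hp]
      push_cast
      ring
    rw [this, Gamma_neg_nat_eq_zero]
    simp

/-- The `m`-th term of the expansion of the integrand. -/
def besselIntegrandTerm (μ z : ℂ) (m : ℕ) (θ : ℝ) : ℂ :=
  ((1 + Real.cos θ : ℝ) : ℂ) ^ fracPart μ *
    (z ^ fracPart μ * Complex.exp (-z) * Complex.cos (μ * θ)) *
      ((z * (1 + Complex.cos θ)) ^ m * (Gamma (fracPart μ + 1 + m))⁻¹)

theorem integral_besselIntegrandTerm {μ z : ℂ} (hz : z ≠ 0) (m : ℕ) :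
    ∫ θ in (0 : ℝ)..Real.pi, besselIntegrandTerm μ z m θ =
      Complex.exp (-z) * (Real.pi * (z / 2) ^ μ *
        intExtend (fun k => kummerCoeff μ k * z ^ k) (m - nearestInt μ.re)) := by
  rw [← besselIntegrand_coeff hz m, ← integral_besselIntegrand_term,
    ← intervalIntegral.integral_const_mul, ← intervalIntegral.integral_const_mul,
    ← intervalIntegral.integral_const_mul]
  refine intervalIntegral.integral_congr_ae ?_
  filter_upwards [ae_abs_lt_pi_zero_pi] with θ hθ hmem
  have hne : ((1 + Real.cos θ : ℝ) : ℂ) ≠ 0 := by exact_mod_cast (one_add_cos_pos (hθ hmem)).ne'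
  rw [besselIntegrandTerm, cpow_add _ _ hne, cpow_natCast, mul_pow]
  push_cast
  ring

theorem intervalIntegrable_besselIntegrandTerm_base (μ z : ℂ) :
    IntervalIntegrable (fun θ : ℝ => ((1 + Real.cos θ : ℝ) : ℂ) ^ fracPart μ *
      (z ^ fracPart μ * Complex.exp (-z) * Complex.cos (μ * θ))) volume 0 Real.pi :=
  (intervalIntegrable_one_add_cos_cpow_zero_pi (fracPart_re_mem μ).1).mul_continuousOn
    (by fun_prop)

theorem aestronglyMeasurable_besselIntegrandTerm (μ z : ℂ) (m : ℕ) :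
    AEStronglyMeasurable (besselIntegrandTerm μ z m)
      (volume.restrict (Set.uIoc 0 Real.pi)) := by
  have hc : Continuous fun θ : ℝ =>
      (z * (1 + Complex.cos θ)) ^ m * (Gamma (fracPart μ + 1 + m))⁻¹ := by fun_prop
  exact (intervalIntegrable_besselIntegrandTerm_base μ z).def'.aestronglyMeasurable.mul
    hc.aestronglyMeasurable

theorem hasSum_besselIntegrandTerm {μ z : ℂ} (hz : z ≠ 0) {θ : ℝ} (hθ : |θ| < Real.pi) :
    HasSum (fun m => besselIntegrandTerm μ z m θ) (besselIntegrand μ z θ) := by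
  rw [besselIntegrand_eq hz hθ, ← mul_assoc]
  exact (summable_norm_pow_mul_inv_Gamma _ _).of_norm.hasSum.mul_left _

/-- Since `|1 + cos θ| ≤ 2`, the series at `2z` dominates, times an integrable factor independent of
`m`. -/
theorem hasSum_integral_besselIntegrand {μ z : ℂ} (hz : z ≠ 0) :
    HasSum (fun m : ℕ => Complex.exp (-z) * (Real.pi * (z / 2) ^ μ *
        intExtend (fun k => kummerCoeff μ k * z ^ k) (m - nearestInt μ.re)))
      (∫ θ in (0 : ℝ)..Real.pi, besselIntegrand μ z θ) := by
  simp only [← integral_besselIntegrandTerm hz]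
  refine intervalIntegral.hasSum_integral_of_dominated_convergence
    (fun m θ => ‖((1 + Real.cos θ : ℝ) : ℂ) ^ fracPart μ *
      (z ^ fracPart μ * Complex.exp (-z) * Complex.cos (μ * θ))‖ *
        ‖(z * 2) ^ m * (Gamma (fracPart μ + 1 + m))⁻¹‖)
    (aestronglyMeasurable_besselIntegrandTerm μ z) (fun m => ae_of_all _ fun θ _ => ?_)
    (ae_of_all _ fun θ _ => (summable_norm_pow_mul_inv_Gamma _ _).mul_left _) ?_ ?_
  · rw [besselIntegrandTerm, norm_mul]
    exact mul_le_mul_of_nonneg_left (norm_incGamma_term_le _ z θ m) (norm_nonneg _)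
  · simp only [tsum_mul_left]
    exact (intervalIntegrable_besselIntegrandTerm_base μ z).norm.mul_const _
  · filter_upwards [ae_abs_lt_pi_zero_pi] with θ hθ hmem
    exact hasSum_besselIntegrandTerm hz (hθ hmem)

/-- The index `m - n` runs over all integers from `-n` on. For `n ≥ 0` the surplus negative indices
contribute zero; for `n < 0` the finite sum restores `0, …, -n-1`. -/
theorem tsum_intExtend_add_sum {f : ℕ → ℂ} (hf : Summable f) (n : ℤ) :
    ∑' m : ℕ, intExtend f (m - n) + ∑ j ∈ Finset.Icc (1 : ℤ) (-n), intExtend f (j - 1) =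
      ∑' k, f k := by
  rcases le_total 0 n with hn | hn
  · lift n to ℕ using hn
    rw [Finset.Icc_eq_empty (by lia), Finset.sum_empty, add_zero]
    have hshift : ∀ k : ℕ, intExtend f ((k + n : ℕ) - (n : ℤ)) = f k := fun k => by
      simp [intExtend]
    have hs : Summable fun m : ℕ => intExtend f (m - (n : ℤ)) :=
      (summable_nat_add_iff n).mp (by simpa only [hshift] using hf)
    rw [← hs.sum_add_tsum_nat_add n, Finset.sum_eq_zero, zero_add]
    · exact tsum_congr hshift
    · intro i hi
      rw [Finset.mem_range] at hi
      exact if_neg (by lia)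
  · obtain ⟨p, rfl⟩ : ∃ p : ℕ, n = -(p : ℤ) := ⟨n.natAbs, by lia⟩
    rw [← hf.sum_add_tsum_nat_add p, add_comm, neg_neg]
    congr 1
    · symm
      refine Finset.sum_bij (fun i _ => (i : ℤ) + 1) ?_ ?_ ?_ ?_
      · intro i hi
        rw [Finset.mem_range] at hi
        exact Finset.mem_Icc.mpr ⟨by lia, by lia⟩
      · intro i _ j _ h
        lia
      · intro j hj
        rw [Finset.mem_Icc] at hj
        exact ⟨(j - 1).toNat, Finset.mem_range.mpr (by lia), by lia⟩
      · intro i _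
        simp [intExtend]
    · refine tsum_congr fun m => ?_
      rw [intExtend, if_pos (by lia), show ((m : ℤ) - -(p : ℤ)).toNat = m + p by lia]

/-- With `N = j - 1`, the powers combine as `2^{-2μ-N} (2z)^{μ+N} = (z/2)^μ z^N`. -/
theorem sumCoeff_mul_cpow {μ z : ℂ} (hz : z ≠ 0) {j : ℤ} (hj : 1 ≤ j) :
    1 / (Real.sqrt Real.pi : ℂ) * (sumCoeff j μ * (2 * z) ^ ((j : ℂ) + μ - 1)) =
      (z / 2) ^ μ * intExtend (fun k => kummerCoeff μ k * z ^ k) (j - 1) := by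
  obtain ⟨N, hN⟩ := Int.eq_ofNat_of_zero_le (sub_nonneg.mpr hj)
  obtain rfl : j = N + 1 := by lia
  have hsqrt : (Real.sqrt Real.pi : ℂ) ≠ 0 := by
    exact_mod_cast (Real.sqrt_pos.mpr Real.pi_pos).ne'
  have hpow : (2 : ℂ) ^ (-2 * μ - N) * 2 ^ (μ + N) = 2 ^ (-μ) := by
    rw [← cpow_add _ _ two_ne_zero]
    ring_nf
  rw [sumCoeff_eq, intExtend, if_pos (by lia), hN, Int.toNat_natCast,
    show ((N + 1 : ℤ) : ℂ) + μ - 1 = μ + N by push_cast; ring, two_mul_cpow hz, div_two_cpow hz,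
    ← hpow, cpow_add _ _ hz, cpow_natCast]
  field_simp

end MixedBessel

end

theorem mainTheorem2 (μ z : ℂ) (hz : z ≠ 0)
    (hlow : -Real.pi < Complex.arg z) (hupp : Complex.arg z ≤ Real.pi / 2) :
    (∀ j ∈ Finset.Icc (1 : ℤ) (-MixedBessel.nearestInt μ.re),
      Filter.Tendsto (MixedBessel.gammaQuotient j) (nhdsWithin μ {μ}ᶜ)
        (nhds (MixedBessel.sumCoeff j μ))) ∧
    IntervalIntegrable
      (fun θ : ℝ => Complex.exp (z * Complex.cos θ) *
        MixedBessel.regIncGamma (MixedBessel.fracPart μ) (z * (1 + Complex.cos θ)) *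
        Complex.cos (μ * θ)) MeasureTheory.volume 0 Real.pi ∧
    MixedBessel.besselI μ z =
      1 / (Real.pi : ℂ) *
        (∫ θ in (0 : ℝ)..Real.pi, Complex.exp (z * Complex.cos θ) *
          MixedBessel.regIncGamma (MixedBessel.fracPart μ) (z * (1 + Complex.cos θ)) *
          Complex.cos (μ * θ)) +
      1 / (Real.sqrt Real.pi : ℂ) * Complex.exp (-z) *
        ∑ j ∈ Finset.Icc (1 : ℤ) (-MixedBessel.nearestInt μ.re),
          MixedBessel.sumCoeff j μ * (2 * z) ^ ((j : ℂ) + μ - 1) := by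
  refine ⟨fun j hj => ?_, MixedBessel.intervalIntegrable_besselIntegrand hz, ?_⟩
  · obtain ⟨N, hN⟩ := Int.eq_ofNat_of_zero_le (sub_nonneg.mpr (Finset.mem_Icc.mp hj).1)
    obtain rfl : j = N + 1 := by lia
    rw [MixedBessel.sumCoeff_eq]
    exact MixedBessel.tendsto_gammaQuotient μ N
  · have hint := (MixedBessel.hasSum_integral_besselIntegrand (μ := μ) hz).tsum_eq
    simp only [MixedBessel.besselIntegrand] at hint
    rw [MixedBessel.besselI_eq μ z hz hlow hupp, ← hint, tsum_mul_left, tsum_mul_left,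
      ← MixedBessel.tsum_intExtend_add_sum (MixedBessel.kummerCoeff_summable μ z)
        (MixedBessel.nearestInt μ.re), mul_right_comm _ (Complex.exp (-z)), Finset.mul_sum]
    have hfin := Finset.sum_congr rfl fun (j : ℤ)
      (hj : j ∈ Finset.Icc (1 : ℤ) (-MixedBessel.nearestInt μ.re)) =>
        MixedBessel.sumCoeff_mul_cpow (μ := μ) hz (Finset.mem_Icc.mp hj).1
    rw [hfin, ← Finset.mul_sum]
    have hpi : (Real.pi : ℂ) ≠ 0 := by exact_mod_cast Real.pi_ne_zero
    field_simp
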